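/- There is a universal constant $C$ such that for all integers $n\ge 0$, $m\ge 1$ and every partial Boolean function $f:\{0,1\}^n\times\{0,1\}^m\to\{0,1,\bot\}$ (where $\bot$ means "undefined"), $$D^{A\to B}(f)\;\le\; C\cdot Q^{A\to B,*}(f)\cdot m .$$ Here $D^{A\to B}(f)$ is the least $c\ge 0$ for which there is a deterministic one-way protocol, in which Alice, who knows $x\in\{0,1\}^n$, sends $c$ bits to Bob, who knows $y\in\{0,1\}^m$ and outputs a bit, such that the output equals $f(x,y)$ whenever $f(x,y)\ne\bot$. Further, $Q^{A\to B,*}(f)$ is the least $q\ge 0$ for which there is an entanglement-assisted quantum one-way protocol with $q$ qubits of communication, such that Bob's output equals $f(x,y)$ with probability at least $2/3$ whenever $f(x,y)\ne\bot$; in such a protocol Alice and Bob share a bipartite quantum state that does not depend on the inputs and has arbitrary finite dimension, Alice applies a quantum channel depending on $x$ from her part of the state to a register of $q$ qubits and sends this register to Bob, and Bob applies a two-outcome measurement depending on $y$ to the message and his part of the shared state. Consequently every entanglement-assisted quantum one-way protocol for $f$ with $q$ qubits of communication can be replaced by a deterministic one-way protocol for $f$ with at most $C\,q\,m$ bits of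 communication. -/

import Mathlib

namespace OneWay

open Matrix
open scoped ComplexOrder Kronecker

/-- Bit strings of length `k`. -/
abbrev Bits (k : ℕ) : Type := Fin k → Bool

/-- A partial Boolean function `f : {0,1}ⁿ × {0,1}ᵐ → {0,1}`; `none` means that `f` is undefined
at the input. -/
abbrev PartialFn (n m : ℕ) : Type := Bits n → Bits m → Option Bool

/-- A density matrix: positive semidefinite of trace one. -/
def IsDensity {ι : Type} [Fintype ι] (ρ : Matrix ι ι ℂ) : Prop :=
  ρ.PosSemidef ∧ ρ.trace = 1

/-- A deterministic one-way protocol in which Alice sends `c` bits to Bob, who outputs a bit. -/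
structure DetProtocol (n m c : ℕ) where
  /-- Alice's message, a function of her input. -/
  message : Bits n → Bits c
  /-- Bob's output, a function of his input and of the message. -/
  output : Bits m → Bits c → Bool

/-- The protocol is correct on every input on which `f` is defined. -/
def DetProtocol.Computes {n m c : ℕ} (P : DetProtocol n m c) (f : PartialFn n m) : Prop :=
  ∀ x y b, f x y = some b → P.output y (P.message x) = b

/-- An entanglement-assisted quantum one-way protocol in which Alice sends `q` qubits to Bob.
The parties share an arbitrary input-independent state on registers of arbitrary finite dimensions
`dA` and `dB`. On input `x`, Alice applies a quantum channel (a completely positive trace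
preserving map, given by Kraus operators) from her register to a register of `q` qubits, which she
sends to Bob. On input `y`, Bob applies a two-outcome measurement to the message and his own
register. -/
structure QuantumProtocol (n m q : ℕ) where
  /-- Dimension of Alice's part of the shared state. -/
  dA : ℕ
  /-- Dimension of Bob's part of the shared state. -/
  dB : ℕ
  /-- The shared state. -/
  state : Matrix (Fin dA × Fin dB) (Fin dA × Fin dB) ℂ
  state_density : IsDensity state
  /-- Number of Kraus operators. -/
  r : ℕ
  /-- The Kraus operators of Alice's channel on input `x`. -/
  kraus : Bits n → Fin r → Matrix (Bits q) (Fin dA) ℂ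
  kraus_trace : ∀ x, ∑ j, (kraus x j)ᴴ * kraus x j = 1
  /-- The measurement operator of Bob on input `y` for the outcome `1`. -/
  effect : Bits m → Matrix (Bits q × Fin dB) (Bits q × Fin dB) ℂ
  effect_nonneg : ∀ y, (effect y).PosSemidef
  effect_le_one : ∀ y, (1 - effect y).PosSemidef

/-- The state of the message and Bob's register after Alice's message on input `x`. -/
noncomputable def QuantumProtocol.received {n m q : ℕ} (P : QuantumProtocol n m q) (x : Bits n) :
    Matrix (Bits q × Fin P.dB) (Bits q × Fin P.dB) ℂ :=
  ∑ j, (P.kraus x j ⊗ₖ (1 : Matrix (Fin P.dB) (Fin P.dB) ℂ)) * P.state *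
    (P.kraus x j ⊗ₖ (1 : Matrix (Fin P.dB) (Fin P.dB) ℂ))ᴴ

/-- The probability that Bob outputs `1` on inputs `x`, `y`. -/
noncomputable def QuantumProtocol.acceptProb {n m q : ℕ} (P : QuantumProtocol n m q)
    (x : Bits n) (y : Bits m) : ℝ :=
  (P.effect y * P.received x).trace.re

/-- On every input on which `f` is defined the output is `f x y` with probability at least `2/3`. -/
def QuantumProtocol.Computes {n m q : ℕ} (P : QuantumProtocol n m q) (f : PartialFn n m) : Prop :=
  ∀ x y, (f x y = some true → 2 / 3 ≤ P.acceptProb x y) ∧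
    (f x y = some false → 2 / 3 ≤ 1 - P.acceptProb x y)

/-- The deterministic one-way communication complexity of `f`. -/
noncomputable def detComplexity {n m : ℕ} (f : PartialFn n m) : ℕ :=
  sInf {c | ∃ P : DetProtocol n m c, P.Computes f}

/-- The entanglement-assisted quantum one-way communication complexity of `f` (error `1/3`). -/
noncomputable def quantumComplexity {n m : ℕ} (f : PartialFn n m) : ℕ :=
  sInf {q | ∃ P : QuantumProtocol n m q, P.Computes f}

/-- The minimum that defines `detComplexity` is over a nonempty set: Alice can send `x`. -/
theorem exists_detProtocol {n m : ℕ} (f : PartialFn n m) :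
    {c | ∃ P : DetProtocol n m c, P.Computes f}.Nonempty :=
  ⟨n, ⟨fun x => x, fun y x => (f x y).getD false⟩, fun x y b h => by simp [h]⟩

/-- The minimum that defines `quantumComplexity` is over a nonempty set: Alice can send `x`. -/
theorem exists_quantumProtocol {n m : ℕ} (f : PartialFn n m) :
    {q | ∃ P : QuantumProtocol n m q, P.Computes f}.Nonempty := by
  classical
  refine ⟨n, ⟨1, 1, 1, ⟨PosSemidef.one, by simp⟩, 1,
    fun x _ => Matrix.of fun z _ => if z = x then 1 else 0, fun x => ?_,
    fun y => Matrix.diagonal fun p => if f p.1 y = some true then 1 else 0, fun y => ?_,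
    fun y => ?_⟩, fun x y => ?_⟩
  · ext i j
    obtain rfl := Subsingleton.elim i j
    simp [Matrix.mul_apply]
  · refine PosSemidef.diagonal fun p => ?_
    dsimp only
    split_ifs <;> simp
  · rw [← Matrix.diagonal_one, Matrix.diagonal_sub]
    refine PosSemidef.diagonal fun p => ?_
    dsimp only
    split_ifs <;> simp
  · constructor <;> intro h <;>
      simp [QuantumProtocol.acceptProb, QuantumProtocol.received, Matrix.trace,
        Matrix.mul_apply, Matrix.diagonal_apply, Fintype.sum_prod_type, h] <;> norm_num

end OneWay

namespace OneWay

open Matrix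
open scoped ComplexOrder Kronecker

/-! ### Relative entropy of positive definite matrices -/

section RelativeEntropy

variable {ι : Type} [Fintype ι]

/-! The link between the two models is the mistake-tree (Littlestone) dimension of `f`, with Bob's
inputs as queries.

If no tree of depth `d + 1` is shattered, Bob answers by the standard optimal algorithm. Alice names
a query on which he errs, and each such correction lowers the depth, so `d` corrections of `m + 1`
bits suffice (`exists_messages`).

Conversely, a shattered tree costs qubits. Alice's channel leaves Bob's marginal fixed, so every
received state is at most `4 ^ q` times one common density matrix `T`, and its relative entropy to
`T` is at most `q * log 4`. Averaging the states up the tree, each node merges two states that Bob's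
effect distinguishes; `relEntropy_midpoint` and the Pinsker bound `sq_le_relEntropy` make the
entropy drop by a constant. It stays nonnegative, so the depth is `O(q)`. -/

theorem re_trace_conjTranspose (X : Matrix ι ι ℂ) : Xᴴ.trace.re = X.trace.re := by
  rw [Matrix.trace_conjTranspose]
  exact Complex.conj_re _

theorem re_trace_nonneg {A : Matrix ι ι ℂ} (hA : A.PosSemidef) : 0 ≤ A.trace.re :=
  (Complex.nonneg_iff.1 hA.trace_nonneg).1

theorem two_mul_re_trace_le (X Y : Matrix ι ι ℂ) (t : ℝ) :
    2 * t * (Xᴴ * Y).trace.re ≤ (Xᴴ * X).trace.re + t ^ 2 * (Yᴴ * Y).trace.re := by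
  have h := re_trace_nonneg (posSemidef_conjTranspose_mul_self (X - (t : ℂ) • Y))
  have h2 : (Yᴴ * X).trace.re = (Xᴴ * Y).trace.re := by
    rw [← re_trace_conjTranspose, Matrix.conjTranspose_mul, Matrix.conjTranspose_conjTranspose]
  simp only [Matrix.conjTranspose_sub, Matrix.conjTranspose_smul, Matrix.sub_mul, Matrix.mul_sub,
    Matrix.trace_sub, Matrix.smul_mul, Matrix.mul_smul, Matrix.trace_smul, Complex.sub_re,
    smul_eq_mul, RCLike.star_def, Complex.conj_ofReal, Complex.re_ofReal_mul, h2] at h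
  linarith

variable [DecidableEq ι]

/-- The joint weights `‖⟨eᵢ, fⱼ⟩‖²` of two eigenbases reduce traces to classical sums. -/
theorem exists_trace_cfc_mul_cfc {A B : Matrix ι ι ℂ} (hA : A.IsHermitian) (hB : B.IsHermitian) :
    ∃ w : ι → ι → ℝ, (∀ i j, 0 ≤ w i j) ∧ ∀ f g : ℝ → ℝ, (cfc f A * cfc g B).trace.re =
      ∑ i, ∑ j, w i j * (f (hA.eigenvalues i) * g (hB.eigenvalues j)) := by
  let U : Matrix ι ι ℂ := hA.eigenvectorUnitary
  let V : Matrix ι ι ℂ := hB.eigenvectorUnitary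
  refine ⟨fun i j => Complex.normSq ((star U * V) i j), fun i j => Complex.normSq_nonneg _,
    fun f g => ?_⟩
  have hc : (cfc f A * cfc g B).trace =
      ∑ i, ∑ j, ((Complex.normSq ((star U * V) i j) *
        (f (hA.eigenvalues i) * g (hB.eigenvalues j)) : ℝ) : ℂ) := by
    rw [hA.cfc_eq, hB.cfc_eq, IsHermitian.cfc, IsHermitian.cfc, Unitary.conjStarAlgAut_apply,
      Unitary.conjStarAlgAut_apply]
    change (U * diagonal _ * star U * (V * diagonal _ * star V)).trace = _
    have e : (U * diagonal ((RCLike.ofReal : ℝ → ℂ) ∘ f ∘ hA.eigenvalues) * star U *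
        (V * diagonal ((RCLike.ofReal : ℝ → ℂ) ∘ g ∘ hB.eigenvalues) * star V)).trace =
        (diagonal ((RCLike.ofReal : ℝ → ℂ) ∘ f ∘ hA.eigenvalues) * (star U * V) *
        (diagonal ((RCLike.ofReal : ℝ → ℂ) ∘ g ∘ hB.eigenvalues) * star (star U * V))).trace := by
      rw [star_mul, star_star]
      simp only [Matrix.mul_assoc]
      rw [Matrix.trace_mul_comm]
      simp only [Matrix.mul_assoc]
    rw [e]
    simp only [Matrix.trace, Matrix.diag, Matrix.mul_apply (M := diagonal _ * _),
      Matrix.diagonal_mul, Matrix.star_apply, Function.comp]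
    refine Finset.sum_congr rfl fun i _ => Finset.sum_congr rfl fun j _ => ?_
    have := Complex.mul_conj ((star U * V) i j)
    push_cast
    rw [← this]
    simp only [RCLike.star_def, Complex.coe_algebraMap]
    ring
  rw [hc]
  simp

theorem continuousOn_spectrum (A : Matrix ι ι ℂ) (f : ℝ → ℝ) : ContinuousOn f (spectrum ℝ A) :=
  A.finite_real_spectrum.continuousOn f

theorem isHermitian_cfc (f : ℝ → ℝ) (A : Matrix ι ι ℂ) : (cfc f A).IsHermitian :=
  cfc_predicate f A

theorem cfc_id_eq {A : Matrix ι ι ℂ} (hA : A.IsHermitian) : cfc (fun p : ℝ => p) A = A :=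
  cfc_id' ℝ A hA.isSelfAdjoint

theorem cfc_one_eq {A : Matrix ι ι ℂ} (hA : A.IsHermitian) : cfc (fun _ : ℝ => (1 : ℝ)) A = 1 :=
  cfc_const_one ℝ A hA.isSelfAdjoint

theorem cfc_mul_eq (f g : ℝ → ℝ) (A : Matrix ι ι ℂ) :
    cfc (fun p => f p * g p) A = cfc f A * cfc g A :=
  cfc_mul f g A (continuousOn_spectrum _ _) (continuousOn_spectrum _ _)

/-- Quantum relative entropy (natural logarithm) of positive definite matrices. -/
noncomputable def relEntropy (A B : Matrix ι ι ℂ) : ℝ :=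
  (A * (cfc Real.log A - cfc Real.log B)).trace.re

theorem relEntropy_eq_sub {A B : Matrix ι ι ℂ} (hA : A.IsHermitian) (hB : B.IsHermitian) :
    relEntropy A B = (cfc (fun p : ℝ => p * Real.log p) A * cfc (fun _ : ℝ => (1 : ℝ)) B).trace.re -
      (cfc (fun p : ℝ => p) A * cfc Real.log B).trace.re := by
  have h1 : cfc (fun p : ℝ => p * Real.log p) A = A * cfc Real.log A := by
    rw [cfc_mul_eq (fun p => p), cfc_id_eq hA]
  rw [h1, cfc_id_eq hA, relEntropy, Matrix.mul_sub, Matrix.trace_sub, Complex.sub_re,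
    cfc_one_eq hB, Matrix.mul_one]

/-- This is `log t ≤ t - 1` at `t = √q / √p`, multiplied by `2 * p`. -/
theorem hellinger_scalar_nonneg {p q : ℝ} (hp : 0 < p) (hq : 0 < q) :
    0 ≤ p * Real.log p - p * Real.log q - 2 * p + 2 * (√p * √q) := by
  have h := Real.log_le_sub_one_of_pos (x := √q / √p) (by positivity)
  rw [Real.log_div (by positivity) (by positivity), Real.log_sqrt hp.le, Real.log_sqrt hq.le] at h
  have h2 := mul_le_mul_of_nonneg_left h (by positivity : 0 ≤ 2 * p)
  have h3 : 2 * p * (√q / √p - 1) = 2 * (√p * √q) - 2 * p := by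
    have h0 : √p ≠ 0 := by positivity
    have h4 : p / √p = √p := Real.div_sqrt
    calc 2 * p * (√q / √p - 1) = 2 * (p / √p * √q) - 2 * p := by ring
      _ = _ := by rw [h4]
  rw [h3] at h2
  linarith

theorem cfc_sqrt_mul_cfc_sqrt {A : Matrix ι ι ℂ} (hA : A.PosSemidef) :
    cfc Real.sqrt A * cfc Real.sqrt A = A := by
  rw [← cfc_mul_eq]
  conv_rhs => rw [← cfc_id_eq hA.1]
  refine cfc_congr fun x hx => ?_
  rw [hA.1.spectrum_real_eq_range_eigenvalues] at hx
  obtain ⟨i, rfl⟩ := hx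
  exact Real.mul_self_sqrt (hA.eigenvalues_nonneg i)

/-- Relative entropy dominates the squared Hellinger distance. -/
theorem hellinger_le_relEntropy {A B : Matrix ι ι ℂ} (hA : A.PosDef) (hB : B.PosDef)
    (hAt : A.trace = 1) (hBt : B.trace = 1) :
    ((cfc Real.sqrt A - cfc Real.sqrt B)ᴴ * (cfc Real.sqrt A - cfc Real.sqrt B)).trace.re ≤
      relEntropy A B := by
  obtain ⟨w, hw, h⟩ := exists_trace_cfc_mul_cfc hA.1 hB.1
  have e : ((cfc Real.sqrt A - cfc Real.sqrt B)ᴴ * (cfc Real.sqrt A - cfc Real.sqrt B)).trace =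
      1 + 1 - 2 * (cfc Real.sqrt A * cfc Real.sqrt B).trace := by
    rw [Matrix.conjTranspose_sub, (isHermitian_cfc _ _).eq, (isHermitian_cfc _ _).eq,
      Matrix.sub_mul, Matrix.mul_sub, Matrix.mul_sub, cfc_sqrt_mul_cfc_sqrt hA.posSemidef,
      cfc_sqrt_mul_cfc_sqrt hB.posSemidef]
    simp only [Matrix.trace_sub, hAt, hBt]
    rw [Matrix.trace_mul_comm (cfc Real.sqrt B)]
    ring
  have h1 := h (fun p => p) (fun _ => 1)
  rw [cfc_id_eq hA.1, cfc_one_eq hB.1, Matrix.mul_one, hAt] at h1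
  rw [e, relEntropy_eq_sub hA.1 hB.1, h]
  -- Since both traces are 1, the constant is twice the trace of `A`; the claim becomes a
  -- `w`-weighted sum of scalar inequalities.
  have h2 : (1 + 1 - 2 * (cfc Real.sqrt A * cfc Real.sqrt B).trace).re =
      2 * (1 : ℂ).re - 2 * (cfc Real.sqrt A * cfc Real.sqrt B).trace.re := by
    simp; norm_num
  rw [h2, h1, h, h]
  rw [← sub_nonneg]
  simp only [Finset.mul_sum, ← Finset.sum_sub_distrib]
  refine Finset.sum_nonneg fun i _ => Finset.sum_nonneg fun j _ => ?_
  have := mul_nonneg (hw i j) (hellinger_scalar_nonneg (hA.eigenvalues_pos i) (hB.eigenvalues_pos j))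
  linarith

theorem relEntropy_nonneg {A B : Matrix ι ι ℂ} (hA : A.PosDef) (hB : B.PosDef)
    (hAt : A.trace = 1) (hBt : B.trace = 1) : 0 ≤ relEntropy A B :=
  (Complex.nonneg_iff.1 (posSemidef_conjTranspose_mul_self _).trace_nonneg).1.trans
    (hellinger_le_relEntropy hA hB hAt hBt)

/-- `E - E² = E(1 - E)E + (1 - E)E(1 - E)`. -/
theorem posSemidef_sub_mul_self {E : Matrix ι ι ℂ} (h0 : E.PosSemidef)
    (h1 : (1 - E).PosSemidef) : (E - E * E).PosSemidef := by
  have h2 := h1.conjTranspose_mul_mul_same E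
  have h3 := h0.conjTranspose_mul_mul_same (1 - E)
  rw [h0.1.eq] at h2
  rw [h1.1.eq] at h3
  convert h2.add h3 using 1
  noncomm_ring

/-- A Pinsker-type inequality: relative entropy bounds the advantage of an effect. -/
theorem sq_le_relEntropy {A B E : Matrix ι ι ℂ} (hA : A.PosDef) (hB : B.PosDef)
    (hAt : A.trace = 1) (hBt : B.trace = 1) (h0 : E.PosSemidef) (h1 : (1 - E).PosSemidef)
    {β : ℝ} (hβ : 0 < β) (h : β ≤ (E * (A - B)).trace.re) : β ^ 2 / 4 ≤ relEntropy A B := by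
  refine le_trans ?_ (hellinger_le_relEntropy hA hB hAt hBt)
  have ha := cfc_sqrt_mul_cfc_sqrt hA.posSemidef
  have hb := cfc_sqrt_mul_cfc_sqrt hB.posSemidef
  have ha' := isHermitian_cfc Real.sqrt A
  have hb' := isHermitian_cfc Real.sqrt B
  set a := cfc Real.sqrt A
  set b := cfc Real.sqrt B
  have key : ∀ C c : Matrix ι ι ℂ, c * c = C → c.IsHermitian → C.trace = 1 →
      ((E * c)ᴴ * (E * c)).trace.re ≤ 1 := by
    intro C c hc hc' hC
    have h2 := re_trace_nonneg ((posSemidef_sub_mul_self h0 h1).conjTranspose_mul_mul_same c)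
    have h3 := re_trace_nonneg (h1.conjTranspose_mul_mul_same c)
    rw [hc'.eq] at h2 h3
    simp only [Matrix.mul_sub, Matrix.sub_mul, Matrix.trace_sub, Complex.sub_re, Matrix.mul_one,
      hc, hC, Complex.one_re, Matrix.mul_assoc] at h2 h3
    rw [Matrix.conjTranspose_mul, hc'.eq, h0.1.eq]
    simp only [Matrix.mul_assoc]
    linarith
  -- Noncommutative form of `a² - b² = (a + b)(a - b)`, valid for the real part of the trace.
  have e : (E * (A - B)).trace.re =
      ((E * a)ᴴ * (a - b)).trace.re + ((E * b)ᴴ * (a - b)).trace.re := by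
    have e1 : (b * (E * a)).trace.re = (a * (E * b)).trace.re := by
      rw [← re_trace_conjTranspose, Matrix.conjTranspose_mul, Matrix.conjTranspose_mul, ha'.eq,
        hb'.eq, h0.1.eq, Matrix.mul_assoc]
    rw [Matrix.conjTranspose_mul, Matrix.conjTranspose_mul, ha'.eq, hb'.eq, h0.1.eq, ← ha, ← hb]
    simp only [Matrix.mul_sub, Matrix.trace_sub, Matrix.mul_assoc, Complex.sub_re]
    rw [e1, Matrix.trace_mul_comm a (E * a), Matrix.trace_mul_comm b (E * b)]
    simp only [Matrix.mul_assoc]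
    ring
  -- The value `2 / β` optimises the resulting lower bound on `H`.
  have i1 := two_mul_re_trace_le (E * a) (a - b) (2 / β)
  have i2 := two_mul_re_trace_le (E * b) (a - b) (2 / β)
  have k1 := key A a ha ha' hAt
  have k2 := key B b hb hb' hBt
  rw [e] at h
  set H := ((a - b)ᴴ * (a - b)).trace.re
  have i3 : 2 * (2 / β) * β ≤ 2 + 2 * (2 / β) ^ 2 * H := by
    have := mul_le_mul_of_nonneg_left h (by positivity : 0 ≤ 2 * (2 / β))
    linarith
  have i4 : 2 * (2 / β) * β = 4 := by field_simp; norm_num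
  have i5 : 2 * (2 / β) ^ 2 * H = 8 * H / β ^ 2 := by ring
  rw [i4, i5] at i3
  have : 2 ≤ 8 * H / β ^ 2 := by linarith
  rw [le_div_iff₀ (by positivity)] at this
  linarith

/-- If `A ≤ a • B` then `relEntropy A B ≤ log a`. -/
theorem relEntropy_le_log {A B : Matrix ι ι ℂ} (hA : A.PosDef) (hB : B.PosDef)
    (hAt : A.trace = 1) {a : ℝ} (ha : 0 < a) (h : ((a : ℂ) • B - A).PosSemidef) :
    relEntropy A B ≤ Real.log a := by
  set X := cfc (fun q : ℝ => q⁻¹) B with hX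
  have hX' : X.IsHermitian := isHermitian_cfc _ _
  have hBX : B * X = 1 := by
    have e : B * X = cfc (fun q : ℝ => q * q⁻¹) B := by
      rw [cfc_mul_eq (fun q => q), cfc_id_eq hB.1]
    rw [e, ← cfc_one_eq hB.1]
    refine cfc_congr fun x hx => ?_
    rw [hB.1.spectrum_real_eq_range_eigenvalues] at hx
    obtain ⟨i, rfl⟩ := hx
    exact mul_inv_cancel₀ (hB.eigenvalues_pos i).ne'
  -- With `z = tr AXA` and `s = tr AXAXA`, the two positivity facts read `s ≤ a z` and `0 ≤ s - 2 a
  -- z + a²`. This replaces operator monotonicity of the logarithm.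
  have hZ : (A * A * X).trace.re ≤ a := by
    have h1 := re_trace_nonneg (h.conjTranspose_mul_mul_same (X * A))
    have h2 := re_trace_nonneg (hA.posSemidef.conjTranspose_mul_mul_same (X * A - (a : ℂ) • 1))
    simp only [Matrix.conjTranspose_sub, Matrix.conjTranspose_smul, Matrix.conjTranspose_mul,
      Matrix.conjTranspose_one, hX'.eq, hA.1.eq, Matrix.sub_mul, Matrix.mul_sub, Matrix.smul_mul,
      Matrix.mul_smul, Matrix.trace_sub, Matrix.trace_smul, Complex.sub_re, smul_eq_mul,
      RCLike.star_def, Complex.conj_ofReal, Complex.re_ofReal_mul, Matrix.mul_one, Matrix.one_mul,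
      Matrix.mul_assoc, hAt, Complex.one_re] at h1 h2
    rw [← Matrix.mul_assoc B X A, hBX, Matrix.one_mul] at h1
    have e2 : (A * (A * X)).trace = (A * (X * A)).trace := by
      rw [← Matrix.mul_assoc A X A, Matrix.trace_mul_comm (A * X)]
    rw [Matrix.mul_assoc, e2]
    nlinarith
  obtain ⟨w, hw, hs⟩ := exists_trace_cfc_mul_cfc hA.1 hB.1
  have h1 := hs (fun p => p) (fun _ => 1)
  rw [cfc_id_eq hA.1, cfc_one_eq hB.1, Matrix.mul_one, hAt, Complex.one_re] at h1
  have hAA : cfc (fun p : ℝ => p * p) A = A * A := by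
    rw [cfc_mul_eq (fun p => p), cfc_id_eq hA.1]
  rw [← hAA, hX, hs] at hZ
  -- This slack absorbs the linear terms when `log t ≤ t - 1` is applied at `t = p / q / a`.
  have hd : 0 ≤ a⁻¹ * (a - ∑ i, ∑ j, w i j *
      (hA.1.eigenvalues i * hA.1.eigenvalues i * (hB.1.eigenvalues j)⁻¹)) :=
    mul_nonneg (by positivity) (sub_nonneg.2 hZ)
  rw [mul_sub, inv_mul_cancel₀ ha.ne', h1] at hd
  have hl := mul_one (Real.log a)
  rw [h1] at hl
  rw [relEntropy_eq_sub hA.1 hB.1, hs, hs, ← hl]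
  refine le_trans (le_add_of_nonneg_right hd) ?_
  rw [← sub_nonneg]
  simp only [Finset.mul_sum, ← Finset.sum_sub_distrib, ← Finset.sum_add_distrib]
  refine Finset.sum_nonneg fun i _ => Finset.sum_nonneg fun j _ => ?_
  have hp := hA.eigenvalues_pos i
  have hq := hB.eigenvalues_pos j
  set p := hA.1.eigenvalues i
  set q := hB.1.eigenvalues j
  have hl := Real.log_le_sub_one_of_pos (x := p / q / a) (by positivity)
  rw [Real.log_div (by positivity) (by positivity), Real.log_div hp.ne' hq.ne'] at hl
  have := mul_le_mul_of_nonneg_left hl (mul_nonneg (hw i j) hp.le)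
  have e3 : w i j * p * (p / q / a - 1) = a⁻¹ * (w i j * (p * p * q⁻¹)) - w i j * p := by
    ring
  rw [e3] at this
  linarith

/-- Compensation identity for the midpoint of two matrices. -/
theorem relEntropy_midpoint (A B M T : Matrix ι ι ℂ) (hM : A + B = (2 : ℂ) • M) :
    relEntropy A T + relEntropy B T =
      2 * relEntropy M T + relEntropy A M + relEntropy B M := by
  have h : A * (cfc Real.log M - cfc Real.log T) + B * (cfc Real.log M - cfc Real.log T) =
      (2 : ℂ) • (M * (cfc Real.log M - cfc Real.log T)) := by
    rw [← Matrix.add_mul, hM, Matrix.smul_mul]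
  have h := congrArg (fun Z : Matrix ι ι ℂ => Z.trace.re) h
  simp only [relEntropy, Matrix.mul_sub, Matrix.trace_sub, Matrix.trace_add, Matrix.trace_smul,
    Complex.sub_re, Complex.add_re, smul_eq_mul, Complex.mul_re, Complex.re_ofNat,
    Complex.im_ofNat, zero_mul, sub_zero] at h ⊢
  linarith

end RelativeEntropy

/-! ### Mistake trees and deterministic protocols -/

section Shattering

variable {n m : ℕ}

/-- `f` admits a complete binary mistake tree of depth `d` all of whose branches are realized by
inputs in `S`. -/
def Shatters (f : PartialFn n m) : ℕ → Set (Bits n) → Prop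
  | 0, S => S.Nonempty
  | d + 1, S => ∃ y, Shatters f d {x ∈ S | f x y = some true} ∧
      Shatters f d {x ∈ S | f x y = some false}

/-- By recursion on the depth: Alice names an input of Bob on which his default answer is wrong,
if there is one. -/
theorem exists_messages (f : PartialFn n m) (d : ℕ) (S : Set (Bits n))
    (hS : ¬ Shatters f (d + 1) S) :
    ∃ (W : Type) (_ : Fintype W) (msg : Bits n → W) (out : Bits m → W → Bool),
      Fintype.card W ≤ 2 ^ (d * (m + 1)) ∧
      ∀ x ∈ S, ∀ y b, f x y = some b → out y (msg x) = b := by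
  classical
  induction d generalizing S with
  | zero =>
    -- Without a tree of depth 1, each `y` admits only one defined value on `S`, so no message is
    -- needed.
    refine ⟨Unit, inferInstance, fun _ => (), fun y _ => decide (∃ x ∈ S, f x y = some true),
      by simp, fun x hx y b h => ?_⟩
    simp only [Shatters, not_exists, not_and] at hS
    cases b with
    | true => simpa using ⟨x, hx, h⟩
    | false =>
      simp only [decide_eq_false_iff_not]
      rintro ⟨x', hx', h'⟩
      exact hS y ⟨x', hx', h'⟩ ⟨x, hx, h⟩
  | succ d ih =>
    -- The default answer is chosen so that the inputs contradicting it shatter a smaller depth.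
    let g : Bits m → Bool := fun y => decide (Shatters f (d + 1) {x ∈ S | f x y = some true})
    have hg : ∀ y, ¬ Shatters f (d + 1) {x ∈ S | f x y = some !(g y)} := by
      intro y h
      by_cases hy : Shatters f (d + 1) {x ∈ S | f x y = some true}
      · have : g y = true := decide_eq_true hy
        rw [this] at h
        exact hS ⟨y, hy, h⟩
      · have : g y = false := decide_eq_false hy
        rw [this] at h
        exact hy h
    choose W hW msg out hcard hcor using fun y => ih _ (hg y)
    let e : ∀ y, W y ↪ Fin (2 ^ (d * (m + 1))) := fun y =>
      (Fintype.equivFin (W y)).toEmbedding.trans (Fin.castLEEmb (hcard y))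
    let wrong : Bits n → Prop := fun x => ∃ y, f x y = some !(g y)
    refine ⟨Option (Σ y, W y), inferInstance,
      fun x => if h : wrong x then some ⟨h.choose, msg _ x⟩ else none,
      fun y w => w.elim (g y) fun p => out p.1 y p.2, ?_, fun x hx y b hb => ?_⟩
    · rw [Fintype.card_option, Fintype.card_sigma]
      have h1 : ∑ y, Fintype.card (W y) ≤ 2 ^ m * 2 ^ (d * (m + 1)) := by
        refine (Finset.sum_le_sum fun y _ => hcard y).trans ?_
        simp
      -- The factor 2 leaves room for the extra message `none`, meaning that all defaults are right.
      have h2 : 2 ^ ((d + 1) * (m + 1)) = 2 * (2 ^ m * 2 ^ (d * (m + 1))) := by ring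
      have h3 : 0 < 2 ^ m * 2 ^ (d * (m + 1)) := by positivity
      omega
    · by_cases h : wrong x
      · simp only [h, ↓reduceDIte, Option.elim_some]
        exact hcor _ x ⟨hx, h.choose_spec⟩ y b hb
      · simp only [h, ↓reduceDIte, Option.elim_none]
        by_contra hne
        refine h ⟨y, ?_⟩
        rw [hb]
        cases b <;> simp_all

/-- A partial function that shatters no tree of depth `d + 1` has a cheap protocol. -/
theorem detComplexity_le (f : PartialFn n m) (d : ℕ) (h : ¬ Shatters f (d + 1) Set.univ) :
    detComplexity f ≤ d * (m + 1) := by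
  obtain ⟨W, _, msg, out, hcard, hcor⟩ := exists_messages f d _ h
  have : Fintype.card W ≤ Fintype.card (Bits (d * (m + 1))) := by simpa using hcard
  obtain ⟨e⟩ := Function.Embedding.nonempty_of_card_le this
  refine Nat.sInf_le ⟨⟨fun x => e (msg x), fun y z => if hz : ∃ w, e w = z then out y hz.choose
    else false⟩, fun x y b hb => ?_⟩
  have hz : ∃ w, e w = e (msg x) := ⟨_, rfl⟩
  have : hz.choose = msg x := e.injective hz.choose_spec
  simp only [hz, ↓reduceDIte, this]
  exact hcor x (Set.mem_univ x) y b hb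

end Shattering

/-! ### Domination of a state by its marginal -/

section PartialTrace

variable {κ β : Type} [Fintype κ]

/-- The partial trace over the first factor. -/
def partialTrace (σ : Matrix (κ × β) (κ × β) ℂ) : Matrix β β ℂ :=
  Matrix.of fun b b' => ∑ a, σ (a, b) (a, b')

theorem posSemidef_partialTrace {σ : Matrix (κ × β) (κ × β) ℂ} (hσ : σ.PosSemidef) :
    (partialTrace σ).PosSemidef := by
  have : partialTrace σ = ∑ a, σ.submatrix (fun b => (a, b)) (fun b => (a, b)) := by
    ext b b'
    simp [partialTrace, Matrix.sum_apply]
  rw [this]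
  exact posSemidef_sum _ fun a _ => hσ.submatrix _

variable [Fintype β]

theorem trace_partialTrace (σ : Matrix (κ × β) (κ × β) ℂ) :
    (partialTrace σ).trace = σ.trace := by
  simp only [Matrix.trace, Matrix.diag, partialTrace, Matrix.of_apply, Fintype.sum_prod_type]
  exact Finset.sum_comm

variable [DecidableEq κ] [DecidableEq β]

/-- A positive operator is dominated by its marginal, up to the dimension of the other factor. -/
theorem posSemidef_card_smul_partialTrace_sub {σ : Matrix (κ × β) (κ × β) ℂ}
    (hσ : σ.PosSemidef) :
    ((Fintype.card κ : ℂ) • ((1 : Matrix κ κ ℂ) ⊗ₖ partialTrace σ) - σ).PosSemidef := by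
  let v : κ → κ × β → ℂ := fun a p => if p.1 = a then 1 else 0
  -- With `P a` the projection onto block `a`, half the sum of `(P a - P c) σ (P a - P c)` is `card
  -- κ` times the block-diagonal part of `σ`, minus `σ`. The terms `c ≠ a` of `h1` complete the
  -- diagonal blocks to the marginal.
  have h1 : ((Fintype.card κ : ℂ) • ∑ a, ∑ c ∈ Finset.univ.erase a, diagonal (v a) *
      σ.submatrix (fun p : κ × β => (c, p.2)) (fun p : κ × β => (c, p.2)) * (diagonal (v a))ᴴ).PosSemidef :=
    (posSemidef_sum _ fun a _ => posSemidef_sum _ fun c _ =>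
      (hσ.submatrix _).mul_mul_conjTranspose_same _).smul (by positivity)
  have h2 : ((2 : ℂ)⁻¹ • ∑ a, ∑ c, diagonal (v a - v c) * σ *
      (diagonal (v a - v c))ᴴ).PosSemidef :=
    (posSemidef_sum _ fun a _ => posSemidef_sum _ fun c _ =>
      hσ.mul_mul_conjTranspose_same _).smul (by positivity)
  convert h1.add h2 using 1
  ext ⟨a, b⟩ ⟨a', b'⟩
  have e : ∀ c : κ, (starRingEnd ℂ) (v c (a', b')) = v c (a', b') := fun c => by
    simp only [v]; split_ifs <;> simp
  simp only [Matrix.sub_apply, Matrix.add_apply, Matrix.smul_apply, kronecker_apply,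
    Matrix.sum_apply, diagonal_conjTranspose, Matrix.mul_diagonal, Matrix.diagonal_mul,
    Matrix.submatrix_apply, Pi.sub_apply, Pi.star_apply, smul_eq_mul, RCLike.star_def,
    map_sub, e]
  have e1 : ∑ x, ∑ y ∈ Finset.univ.erase x, v x (a, b) * σ (y, b) (y, b') * v x (a', b') =
      if a = a' then ∑ y ∈ Finset.univ.erase a, σ (y, b) (y, b') else 0 := by
    rw [Finset.sum_eq_single a (fun x _ hx => by simp [v, hx.symm]) (by simp)]
    by_cases h : a = a'
    · simp [v, h]
    · simp [v, h, Ne.symm h]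
  have e2 : ∑ x, ∑ y, (v x (a, b) - v y (a, b)) * σ (a, b) (a', b') *
      (v x (a', b') - v y (a', b')) =
      2 * ((if a = a' then (Fintype.card κ : ℂ) else 0) - 1) * σ (a, b) (a', b') := by
    have s1 : ∀ p, ∑ x, v x p = 1 := fun p => by simp [v]
    have s2 : ∑ x, v x (a, b) * v x (a', b') = if a = a' then 1 else 0 := by
      simp [v, eq_comm]
    have s3 : ∀ x y, (v x (a, b) - v y (a, b)) * σ (a, b) (a', b') *
        (v x (a', b') - v y (a', b')) = (v x (a, b) * v x (a', b') + v y (a, b) * v y (a', b') -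
          v x (a, b) * v y (a', b') - v x (a', b') * v y (a, b)) * σ (a, b) (a', b') :=
      fun x y => by ring
    simp only [s3, ← Finset.sum_mul, Finset.sum_sub_distrib, Finset.sum_add_distrib,
      ← Finset.mul_sum, s1, s2, Finset.sum_const, Finset.card_univ, nsmul_eq_mul, mul_one,
      mul_assoc]
    split_ifs <;> ring
  rw [e1, e2, Matrix.one_apply]
  by_cases h : a = a'
  · subst h
    simp only [if_true, one_mul, partialTrace, Matrix.of_apply]
    rw [← Finset.add_sum_erase _ _ (Finset.mem_univ a)]
    ring
  · simp [h]

end PartialTrace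

/-! ### No signalling from Alice's channel -/

section Received

variable {n m q : ℕ} (P : QuantumProtocol n m q)

theorem QuantumProtocol.posSemidef_received (x : Bits n) : (P.received x).PosSemidef :=
  posSemidef_sum _ fun _ _ => P.state_density.1.mul_mul_conjTranspose_same _

theorem QuantumProtocol.partialTrace_received (x : Bits n) :
    partialTrace (P.received x) = partialTrace P.state := by
  have hk : ∀ k l, ∑ j, ∑ a, star (P.kraus x j a l) * P.kraus x j a k =
      if l = k then 1 else 0 := by
    intro k l
    have := congrFun (congrFun (P.kraus_trace x) l) k
    simpa [Matrix.sum_apply, Matrix.mul_apply, Matrix.one_apply] using this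
  ext b b'
  have e : ∀ a, P.received x (a, b) (a, b') =
      ∑ j, ∑ l, ∑ k, star (P.kraus x j a l) * P.kraus x j a k * P.state (k, b) (l, b') := by
    intro a
    simp only [QuantumProtocol.received, Matrix.sum_apply, Matrix.mul_apply,
      Fintype.sum_prod_type, kronecker_apply, Matrix.conjTranspose_apply, Matrix.one_apply]
    simp only [mul_ite, mul_one, mul_zero, ite_mul, zero_mul, Finset.sum_ite_eq, Finset.mem_univ,
      if_true, apply_ite star, star_zero]
    refine Finset.sum_congr rfl fun j _ => Finset.sum_congr rfl fun l _ => ?_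
    rw [Finset.sum_mul]
    exact Finset.sum_congr rfl fun k _ => by ring
  simp only [partialTrace, Matrix.of_apply, e]
  calc _ = ∑ l, ∑ k, (∑ j, ∑ a, star (P.kraus x j a l) * P.kraus x j a k) *
        P.state (k, b) (l, b') := by
        simp only [Finset.sum_mul]
        rw [Finset.sum_comm]
        exact (Finset.sum_congr rfl fun j _ => Finset.sum_comm.trans
          (Finset.sum_congr rfl fun l _ => Finset.sum_comm)).trans
          (Finset.sum_comm.trans (Finset.sum_congr rfl fun l _ => Finset.sum_comm))
    _ = _ := by simp only [hk]; simp

end Received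

/-! ### Entropy decrement along a mistake tree -/

/-- A shattered tree of depth `d` yields an average of the states `σ x` whose relative entropy to
`T` is `Ω(d)` below the bound `log a` that holds for each `σ x`. -/
theorem exists_relEntropy_add_le {n m : ℕ} {ι : Type} [Fintype ι] [DecidableEq ι] {f : PartialFn n m}
    {σ : Bits n → Matrix ι ι ℂ} {T : Matrix ι ι ℂ} {E : Bits m → Matrix ι ι ℂ} {a : ℝ}
    {u : Bits m → ℝ} (ha : 0 < a) (hσ : ∀ x, (σ x).PosDef) (hσt : ∀ x, (σ x).trace = 1)
    (hT : T.PosDef) (hσT : ∀ x, ((a : ℂ) • T - σ x).PosSemidef)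
    (hE0 : ∀ y, (E y).PosSemidef) (hE1 : ∀ y, (1 - E y).PosSemidef)
    (h1 : ∀ x y, f x y = some true → u y + 1 / 12 ≤ (E y * σ x).trace.re)
    (h0 : ∀ x y, f x y = some false → (E y * σ x).trace.re ≤ u y - 1 / 12)
    (d : ℕ) (S : Set (Bits n)) (hS : Shatters f d S) :
    ∃ ρ : Matrix ι ι ℂ, ρ.PosDef ∧ ρ.trace = 1 ∧ relEntropy ρ T + d / 1152 ≤ Real.log a ∧
      (∀ y v, (∀ x ∈ S, v ≤ (E y * σ x).trace.re) → v ≤ (E y * ρ).trace.re) ∧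
      ∀ y v, (∀ x ∈ S, (E y * σ x).trace.re ≤ v) → (E y * ρ).trace.re ≤ v := by
  -- The last two conclusions retain from "`ρ` is an average of `σ x` over `S`" just what the next
  -- node needs.
  induction d generalizing S with
  | zero =>
    obtain ⟨x, hx⟩ := hS
    exact ⟨σ x, hσ x, hσt x, by simpa using relEntropy_le_log (hσ x) hT (hσt x) ha (hσT x),
      fun y v h => h x hx, fun y v h => h x hx⟩
  | succ d ih =>
    obtain ⟨y, hS1, hS0⟩ := hS
    obtain ⟨ρ₁, hp₁, ht₁, hr₁, hl₁, hu₁⟩ := ih _ hS1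
    obtain ⟨ρ₀, hp₀, ht₀, hr₀, hl₀, hu₀⟩ := ih _ hS0
    have hy₁ := hl₁ y (u y + 1 / 12) fun x hx => h1 x y hx.2
    have hy₀ := hu₀ y (u y - 1 / 12) fun x hx => h0 x y hx.2
    have htr : ∀ y, (E y * ((2 : ℂ)⁻¹ • (ρ₁ + ρ₀))).trace.re =
        ((E y * ρ₁).trace.re + (E y * ρ₀).trace.re) / 2 := by
      intro y
      have : (2 : ℂ)⁻¹ = ((2⁻¹ : ℝ) : ℂ) := by simp
      rw [this, Matrix.mul_smul, Matrix.trace_smul, smul_eq_mul, Complex.re_ofReal_mul,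
        Matrix.mul_add, Matrix.trace_add, Complex.add_re]
      ring
    have hp : ((2 : ℂ)⁻¹ • (ρ₁ + ρ₀)).PosDef := (hp₁.add hp₀).smul (by positivity)
    have ht : ((2 : ℂ)⁻¹ • (ρ₁ + ρ₀)).trace = 1 := by
      rw [Matrix.trace_smul, Matrix.trace_add, ht₁, ht₀]; norm_num
    refine ⟨(2 : ℂ)⁻¹ • (ρ₁ + ρ₀), hp, ht, ?_, fun y v h => ?_, fun y v h => ?_⟩
    · have key := relEntropy_midpoint ρ₁ ρ₀ ((2 : ℂ)⁻¹ • (ρ₁ + ρ₀)) T (by simp)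
      have hd₀ := relEntropy_nonneg hp₀ hp ht₀ ht
      -- The midpoint lies at half of the gap `1 / 6`. Hence the gain is `(1 / 12)² / 4 = 1 / 576`,
      -- halved by the midpoint identity; the other divergence is only bounded below by 0.
      have hd₁ := sq_le_relEntropy hp₁ hp ht₁ ht (hE0 y) (hE1 y)
        (show (0 : ℝ) < 1 / 12 by norm_num) (by
          rw [Matrix.mul_sub, Matrix.trace_sub, Complex.sub_re, htr]; linarith)
      push_cast
      linarith
    · rw [htr]
      have := hl₁ y v fun x hx => h x hx.1
      have := hl₀ y v fun x hx => h x hx.1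
      linarith
    · rw [htr]
      have := hu₁ y v fun x hx => h x hx.1
      have := hu₀ y v fun x hx => h x hx.1
      linarith

theorem QuantumProtocol.div_le_of_shatters {n m q : ℕ} (P : QuantumProtocol n m q)
    {f : PartialFn n m} (hP : P.Computes f) {d : ℕ} (hd : Shatters f d Set.univ) :
    (d : ℝ) / 1152 ≤ q * Real.log 4 := by
  classical
  let ι := Bits q × Fin P.dB
  have hN : 0 < Fintype.card ι := by
    rw [Fintype.card_pos_iff]
    by_contra h
    have : IsEmpty (Fin P.dB) := by
      by_contra h'
      rw [not_isEmpty_iff] at h'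
      exact h (inferInstance : Nonempty (Bits q × Fin P.dB))
    have := P.state_density.2
    simp [Matrix.trace] at this
  have hNne : (Fintype.card ι : ℂ) ≠ 0 := by exact_mod_cast hN.ne'
  set N : ℂ := (Fintype.card ι : ℂ) with hNdef
  have hNpos : 0 < N := by rw [hNdef]; exact_mod_cast hN
  let B := partialTrace P.state
  -- Mixing with the maximally mixed state gives positive definiteness and halves Bob's bias.
  let mix : Matrix ι ι ℂ → Matrix ι ι ℂ := fun A => (2 : ℂ)⁻¹ • A + (2 * N)⁻¹ • 1
  have mix_posDef : ∀ A, A.PosSemidef → (mix A).PosDef := fun A hA =>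
    PosDef.posSemidef_add (hA.smul (by positivity)) (PosDef.one.smul (by positivity))
  have mix_trace : ∀ A, A.trace = 1 → (mix A).trace = 1 := fun A hA => by
    simp only [mix, Matrix.trace_add, Matrix.trace_smul, hA, Matrix.trace_one, smul_eq_mul]
    rw [← hNdef]
    field_simp
    norm_num
  have hrt : ∀ x, (P.received x).trace = 1 := fun x => by
    rw [← trace_partialTrace, P.partialTrace_received, trace_partialTrace, P.state_density.2]
  let T₀ : Matrix ι ι ℂ := ((2 : ℂ) ^ q)⁻¹ • ((1 : Matrix (Bits q) (Bits q) ℂ) ⊗ₖ B)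
  have hT₀ : T₀.PosSemidef :=
    (PosSemidef.one.kronecker (posSemidef_partialTrace P.state_density.1)).smul (by positivity)
  -- One factor `2 ^ q` is the message dimension, the other normalises `T₀`.
  have hdom : ∀ x, ((((4 : ℝ) ^ q : ℝ) : ℂ) • mix T₀ - mix (P.received x)).PosSemidef := by
    intro x
    have h := posSemidef_card_smul_partialTrace_sub (P.posSemidef_received x)
    rw [P.partialTrace_received] at h
    have h4 : (0 : ℂ) ≤ 4 ^ q - 1 := by
      have : (1 : ℝ) ≤ 4 ^ q := one_le_pow₀ (by norm_num)
      exact_mod_cast sub_nonneg.2 this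
    have h2 : ((((4 : ℂ) ^ q - 1) * (2 * N)⁻¹) • (1 : Matrix ι ι ℂ)).PosSemidef :=
      PosSemidef.one.smul (mul_nonneg h4 (by positivity))
    have h3 := (h.smul (show (0 : ℂ) ≤ 2⁻¹ by positivity)).add h2
    convert h3 using 1
    have hp : (4 : ℂ) ^ q * (2 ^ q)⁻¹ = 2 ^ q := by
      rw [show (4 : ℂ) = 2 * 2 by norm_num, mul_pow]
      field_simp
    have hc : (Fintype.card (Bits q) : ℂ) = 2 ^ q := by simp
    rw [hc, ← hp]
    simp only [mix, T₀, B]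
    push_cast
    module
  have htr : ∀ x y, (P.effect y * mix (P.received x)).trace.re =
      P.acceptProb x y / 2 + (P.effect y * ((2 * N)⁻¹ • (1 : Matrix ι ι ℂ))).trace.re := by
    intro x y
    have : (2 : ℂ)⁻¹ = ((2⁻¹ : ℝ) : ℂ) := by simp
    simp only [mix]
    rw [Matrix.mul_add, Matrix.trace_add, Complex.add_re, this, Matrix.mul_smul,
      Matrix.trace_smul, smul_eq_mul, Complex.re_ofReal_mul, QuantumProtocol.acceptProb]
    ring
  have hT₀t : T₀.trace = 1 := by
    simp only [T₀, B]
    rw [Matrix.trace_smul, Matrix.trace_kronecker, trace_partialTrace, P.state_density.2]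
    simp
  obtain ⟨ρ, hp, ht, hr, -⟩ := exists_relEntropy_add_le (f := f) (σ := fun x => mix (P.received x))
    (T := mix T₀) (E := P.effect) (a := 4 ^ q)
    -- After halving, the thresholds `2 / 3` and `1 / 3` become `1 / 4 ± 1 / 12`, up to the shift
    -- from the noise.
    (u := fun y => 1 / 4 + (P.effect y * ((2 * N)⁻¹ • (1 : Matrix ι ι ℂ))).trace.re)
    (by positivity) (fun x => mix_posDef _ (P.posSemidef_received x))
    (fun x => mix_trace _ (hrt x)) (mix_posDef _ hT₀) hdom P.effect_nonneg P.effect_le_one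
    (fun x y h => by rw [htr]; linarith [(hP x y).1 h])
    (fun x y h => by rw [htr]; linarith [(hP x y).2 h]) d Set.univ hd
  have := relEntropy_nonneg hp (mix_posDef _ hT₀) ht (mix_trace _ hT₀t)
  rw [Real.log_pow] at hr
  linarith

/-- Every entanglement-assisted quantum one-way protocol with `q` qubits can be replaced by a
deterministic one-way protocol with `O(q m)` bits. -/
theorem QuantumProtocol.detComplexity_le {n m q : ℕ} (P : QuantumProtocol n m q)
    {f : PartialFn n m} (hP : P.Computes f) (hm : 1 ≤ m) :
    detComplexity f ≤ 4608 * (q * m) := by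
  -- `2304 = 1152 * 2`, by `log 4 ≤ 2`; the final doubling is `m + 1 ≤ 2 * m`.
  refine (OneWay.detComplexity_le f (2304 * q) fun h => ?_).trans ?_
  · have h1 := P.div_le_of_shatters hP h
    have h2 : Real.log 4 ≤ 2 := by
      rw [show (4 : ℝ) = 2 ^ 2 by norm_num, Real.log_pow]
      have := Real.log_two_lt_d9
      norm_num
      linarith
    have h3 := mul_le_mul_of_nonneg_left h2 (Nat.cast_nonneg (α := ℝ) q)
    push_cast at h1
    linarith
  · calc 2304 * q * (m + 1) ≤ 2304 * q * (2 * m) := Nat.mul_le_mul_left _ (by omega)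
      _ = 4608 * (q * m) := by ring

end OneWay

theorem theorem1 : ∃ C : ℕ, ∀ (n m : ℕ), 1 ≤ m → ∀ f : OneWay.PartialFn n m,
    OneWay.detComplexity f ≤ C * (OneWay.quantumComplexity f * m) := by
  refine ⟨4608, fun n m hm f => ?_⟩
  obtain ⟨P, hP⟩ : ∃ P : OneWay.QuantumProtocol n m (OneWay.quantumComplexity f), P.Computes f :=
    Nat.sInf_mem (OneWay.exists_quantumProtocol f)
  exact P.detComplexity_le hP hm
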